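/- Let $\Bbbk$ be a nonzero commutative ring with $1$, let $I$ be a finite set, and let $M=(m_{ij})_{i,j\in I}$ be a Coxeter matrix ($m_{ii}=1$ and $m_{ij}=m_{ji}\in\{2,3,\dots\}\cup\{\infty\}$ for $i\neq j$), with Coxeter group $W$. In the Coxeter graph of $W$ on the node set $I$, distinct nodes $i,j$ are joined iff $m_{ij}\geqslant 3$ (including $m_{ij}=\infty$); the edge is multiple if $m_{ij}\geqslant 4$ (including $\infty$), and the graph is simply laced if it has no multiple edge. Assume that $W$ is irreducible, that is, the Coxeter graph is non-empty and connected. Let $J$ be the set of pairs $\{i,j\}$, $i\neq j$, with $m_{ij}<\infty$; for $j_0=\{i,j\}\in J$ let $\mathbf v_{j_0}=\mathbf s_i\mathbf s_j\mathbf s_i\cdots$ and $\mathbf w_{j_0}=\mathbf s_j\mathbf s_i\mathbf s_j\cdots$ be the two braid words, with $m_{ij}$ letters each, and let $J_{<k}=\{\{i,j\}\in J: m_{ij}<k\}$. Let $\mathbf d=(d_i)_{i\in I}$ be integers with $d_i\geqslant 2$ for all $i$. For $J_0\subseteq J$, the nil-Hecke algebra $n\mathcal H(W,\mathbf d,J_0)$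 is the unital associative $\Bbbk$-algebra generated by $\mathbf s_i$ $(i\in I)$ with relations $\mathbf s_i^{d_i}=0$ for all $i\in I$, $\mathbf v_j=\mathbf w_j$ for $j\in J_0$, and $\mathbf v_j=0=\mathbf w_j$ for $j\in J\setminus J_0$. Then $J_{<1}=J_{<2}$, so $n\mathcal H(W,\mathbf d,J_{<1})=n\mathcal H(W,\mathbf d,J_{<2})$, and this algebra is a finitely generated $\Bbbk$-module if and only if exactly one of the following occurs: 1. The Coxeter graph of $W$ is a tree with exactly one multiple edge $\{i_0,j_0\}$, where $4\leqslant m_{i_0j_0}<\infty$, and $d_i=2$ for all $i\in I$. In this case, if removing the edge $\{i_0,j_0\}$ yields trees with $a$ and $b$ nodes respectively, then $n\mathcal H(W,\mathbf d,J_{<2})$ is a free $\Bbbk$-module of rank $$\begin{cases}\frac12 m_{i_0j_0}|I|^2+1-2ab,&\text{if } m_{i_0j_0}\text{ is even},\\ \frac12(m_{i_0j_0}-1)|I|^2+1,&\text{if } m_{i_0j_0}\text{ is odd}.\end{cases}$$ 2. The Coxeter graph of $W$ is a simply laced tree, and at most one node $i\in I$ satisfies $d_i\geqslant 3$. In this case,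 if $i_0\in I$ is such that $d_i=2$ for all $i\neq i_0$, then $n\mathcal H(W,\mathbf d,J_{<2})$ is a free $\Bbbk$-module of rank $1+|I|^2(d_{i_0}-1)$. -/

import Mathlib

/-- The index set `J` of the braid relations: the unordered pairs `{i, j}` of distinct nodes
with `m_ij` finite (in a `CoxeterMatrix`, the entry `0` stands for `∞`). -/
def CoxeterMatrix.braidIndex {I : Type*} (M : CoxeterMatrix I) : Set (Sym2 I) :=
  {p | ∃ i j : I, p = s(i, j) ∧ i ≠ j ∧ M i j ≠ 0}

/-- `J_{<k}`: the braid relations whose two words have length `m_ij < k`. -/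
def CoxeterMatrix.braidIndexLT {I : Type*} (M : CoxeterMatrix I) (k : ℕ) : Set (Sym2 I) :=
  {p | ∃ i j : I, p = s(i, j) ∧ i ≠ j ∧ M i j ≠ 0 ∧ M i j < k}

/-- The monomial in the free algebra `𝕜⟨𝐬_i : i ∈ I⟩` spelled by a word in the nodes. -/
def nilHeckeMonomial (𝕜 : Type*) [CommRing 𝕜] {I : Type*} (w : List I) : FreeAlgebra 𝕜 I :=
  (w.map (FreeAlgebra.ι 𝕜)).prod

/-- The defining relations of the nil-Hecke algebra `n𝓗(W, d, J₀)`. The two sides of the braid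
relation of `{i, j}` are `M.braidWord i j` and `M.braidWord j i`; in `vanish`, both sides are set
equal to zero, since `i` and `j` may be interchanged. -/
inductive NilHeckeRel (𝕜 : Type*) [CommRing 𝕜] {I : Type*} (M : CoxeterMatrix I) (d : I → ℕ)
    (J₀ : Set (Sym2 I)) : FreeAlgebra 𝕜 I → FreeAlgebra 𝕜 I → Prop
  | order (i : I) : NilHeckeRel 𝕜 M d J₀ (FreeAlgebra.ι 𝕜 i ^ d i) 0
  | braid (i j : I) (h : s(i, j) ∈ M.braidIndex) (h₀ : s(i, j) ∈ J₀) :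
      NilHeckeRel 𝕜 M d J₀ (nilHeckeMonomial 𝕜 (CoxeterSystem.braidWord M i j))
        (nilHeckeMonomial 𝕜 (CoxeterSystem.braidWord M j i))
  | vanish (i j : I) (h : s(i, j) ∈ M.braidIndex) (h₀ : s(i, j) ∉ J₀) :
      NilHeckeRel 𝕜 M d J₀ (nilHeckeMonomial 𝕜 (CoxeterSystem.braidWord M i j)) 0

/-- The nil-Hecke algebra `n𝓗(W, d, J₀)` over `𝕜` of the Coxeter group `W` with Coxeter
matrix `M`, for `d_i < ∞` and `J₀ ⊆ J`. -/
abbrev NilHecke (𝕜 : Type*) [CommRing 𝕜] {I : Type*} (M : CoxeterMatrix I) (d : I → ℕ)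
    (J₀ : Set (Sym2 I)) : Type _ :=
  RingQuot (NilHeckeRel 𝕜 M d J₀)

/-- The simple graph underlying the Coxeter (multi)graph: distinct nodes `i, j` are joined iff
`m_ij ≥ 3` or `m_ij = ∞`, that is, iff `m_ij ≠ 2`. -/
def CoxeterMatrix.coxeterGraph {I : Type*} (M : CoxeterMatrix I) : SimpleGraph I where
  Adj i j := i ≠ j ∧ M i j ≠ 2
  symm := ⟨fun i j h => ⟨h.1.symm, by rw [M.symmetric]; exact h.2⟩⟩
  loopless := ⟨fun _ h => h.1 rfl⟩

/-- The multiple edges of the Coxeter (multi)graph: those with `4 ≤ m_ij ≤ ∞`. -/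
def CoxeterMatrix.multipleEdges {I : Type*} (M : CoxeterMatrix I) : Set (Sym2 I) :=
  {p | ∃ i j : I, p = s(i, j) ∧ i ≠ j ∧ (4 ≤ M i j ∨ M i j = 0)}

/-- The Coxeter graph has no multiple edge, i.e. every `m_ij` with `i ≠ j` is `2` or `3`. -/
def CoxeterMatrix.HasNoMultipleEdge {I : Type*} (M : CoxeterMatrix I) : Prop :=
  M.multipleEdges = ∅

/-- The number of nodes in the connected component of `i` once the edge `{i, j}` is removed from
the Coxeter graph. -/
noncomputable def CoxeterMatrix.branchSize {I : Type*} (M : CoxeterMatrix I) (i j : I) : ℕ :=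
  ((M.coxeterGraph.deleteEdges {s(i, j)}).connectedComponentMk i).supp.ncard

/-- `i₀ j₀` is the only multiple edge of a Coxeter graph which is a tree, `4 ≤ m_{i₀ j₀} < ∞`,
and all `d_i` equal `2`. -/
def CoxeterMatrix.IsOneMultipleEdgeTree {I : Type*} (M : CoxeterMatrix I) (d : I → ℕ)
    (i₀ j₀ : I) : Prop :=
  M.coxeterGraph.IsTree ∧ M.multipleEdges = {s(i₀, j₀)} ∧ 4 ≤ M i₀ j₀ ∧ ∀ i, d i = 2

/-- The Coxeter graph is a simply laced tree, and at most one node `i` has `d_i ≥ 3`. -/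
def CoxeterMatrix.IsSimplyLacedTree {I : Type*} (M : CoxeterMatrix I) (d : I → ℕ) : Prop :=
  M.coxeterGraph.IsTree ∧ M.HasNoMultipleEdge ∧ {i : I | 3 ≤ d i}.Subsingleton

/-! A finite off-diagonal `m_ij` is at least 2, so `J_{<2}` is empty and every defining relation
sets a word to zero. The algebra is monomial: the words without forbidden factor form a basis
(`exists_basis_monomialAlgebra`), and it remains to count them.

Such a word is a walk in the Coxeter graph, possibly with pauses. A pause at `i` needs `d_i ≥ 3`,
and turning back over an edge needs `m_ij ≥ 4`. An infinite label, a cycle, or two distinct places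
to pause or turn back let the walk go on forever (`IsAdmissibleSeq`), so the rank is infinite.
Otherwise the graph is one of the two kinds of tree (`classification_of_finite`).

Both kinds are counted together. Call a pause at the special node, or a crossing of the multiple
edge, a jump. The other edges form a forest, rooted at the special node or at the two ends of the
multiple edge; `ρ` sends a vertex to its root and `σ` a root to the target of the jump there.
Between jumps the walk is a path of the forest, hence unique. Each tree has only one root, so all
jumps are consecutive. A nonempty word is thus determined by its ends `x`, `y` and its number `n` of
jumps, and it exists iff `σ^n (ρ x) = ρ y` (`nonempty_equiv_reducedWord`). The remaining relation
bounds `n` by `n < d - 1` or `n < m - 1`. Counting the triples, and adding the empty word, gives the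
ranks. -/

/-- A word avoids a set of words if none of them is a factor of it. -/
def Avoids {I : Type*} (F : Set (List I)) (w : List I) : Prop := ∀ f ∈ F, ¬ f <:+: w

theorem Avoids.of_infix {I : Type*} {F : Set (List I)} {v w : List I} (hw : Avoids F w)
    (h : v <:+: w) : Avoids F v := fun f hf hv => hw f hf (hv.trans h)

/-! ### Monomial algebras and their bases of words -/

section MonomialAlgebra

variable {𝕜 : Type*} [CommRing 𝕜] {I : Type*}

theorem nilHeckeMonomial_cons (i : I) (w : List I) :
    nilHeckeMonomial 𝕜 (i :: w) = FreeAlgebra.ι 𝕜 i * nilHeckeMonomial 𝕜 w := by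
  simp [nilHeckeMonomial]

theorem nilHeckeMonomial_append (v w : List I) :
    nilHeckeMonomial 𝕜 (v ++ w) = nilHeckeMonomial 𝕜 v * nilHeckeMonomial 𝕜 w := by
  simp [nilHeckeMonomial]

theorem span_nilHeckeMonomial :
    Submodule.span 𝕜 (Set.range (nilHeckeMonomial 𝕜 : List I → FreeAlgebra 𝕜 I)) = ⊤ := by
  rw [eq_top_iff]
  rintro x -
  induction x using FreeAlgebra.induction with
  | grade0 r =>
    rw [Algebra.algebraMap_eq_smul_one]
    exact Submodule.smul_mem _ _ (Submodule.subset_span ⟨[], by simp [nilHeckeMonomial]⟩)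
  | grade1 i => exact Submodule.subset_span ⟨[i], by simp [nilHeckeMonomial]⟩
  | add a b ha hb => exact Submodule.add_mem _ ha hb
  | mul a b ha hb =>
    have h := Submodule.mul_mem_mul ha hb
    rw [Submodule.span_mul_span] at h
    refine Submodule.span_mono ?_ h
    rintro _ ⟨_, ⟨v, rfl⟩, _, ⟨w, rfl⟩, rfl⟩
    exact ⟨v ++ w, nilHeckeMonomial_append v w⟩

variable (𝕜) in
open Classical in
/-- The basis vector of a word that avoids `F`, and zero for the other words. -/
noncomputable def wordVector (F : Set (List I)) (w : List I) : {w // Avoids F w} →₀ 𝕜 :=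
  if h : Avoids F w then Finsupp.single ⟨w, h⟩ 1 else 0

variable (𝕜) in
/-- Left multiplication by letters on the span of the words that avoid `F`. -/
noncomputable def wordAction (F : Set (List I)) :
    FreeAlgebra 𝕜 I →ₐ[𝕜] Module.End 𝕜 ({w // Avoids F w} →₀ 𝕜) :=
  FreeAlgebra.lift 𝕜 fun i => Finsupp.linearCombination 𝕜 fun w => wordVector 𝕜 F (i :: w.1)

/-- This holds for all `w`, as a word with a forbidden factor keeps it when a letter is prepended.
-/
theorem wordAction_ι (F : Set (List I)) (i : I) (w : List I) :
    wordAction 𝕜 F (FreeAlgebra.ι 𝕜 i) (wordVector 𝕜 F w) = wordVector 𝕜 F (i :: w) := by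
  by_cases h : Avoids F w
  · simp [wordAction, wordVector, h]
  · have h' : ¬ Avoids F (i :: w) := fun h' => h (h'.of_infix (List.suffix_cons i w).isInfix)
    simp [wordVector, h, h']

theorem wordAction_monomial (F : Set (List I)) (v w : List I) :
    wordAction 𝕜 F (nilHeckeMonomial 𝕜 v) (wordVector 𝕜 F w) = wordVector 𝕜 F (v ++ w) := by
  induction v with
  | nil => simp [nilHeckeMonomial]
  | cons i v ih =>
    rw [nilHeckeMonomial_cons, map_mul, Module.End.mul_apply, ih, wordAction_ι, List.cons_append]

theorem wordAction_eq_zero {F : Set (List I)} {f : List I} (hf : f ∈ F) :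
    wordAction 𝕜 F (nilHeckeMonomial 𝕜 f) = 0 := by
  ext1 w
  ext1
  have h : ¬ Avoids F (f ++ w.1) := fun h => h f hf (List.prefix_append _ _).isInfix
  have := wordAction_monomial (𝕜 := 𝕜) F f w.1
  rw [wordVector, wordVector, dif_pos w.2, dif_neg h] at this
  simpa using this

/-- A monomial algebra has a basis consisting of the words that avoid the monomial relations. -/
theorem exists_basis_monomialAlgebra {F : Set (List I)} (hF : [] ∉ F)
    {r : FreeAlgebra 𝕜 I → FreeAlgebra 𝕜 I → Prop}
    (h₁ : ∀ x y, r x y → ∃ f ∈ F, x = nilHeckeMonomial 𝕜 f ∧ y = 0)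
    (h₂ : ∀ f ∈ F, r (nilHeckeMonomial 𝕜 f) 0) :
    Nonempty (Module.Basis {w // Avoids F w} 𝕜 (RingQuot r)) := by
  let π := RingQuot.mkAlgHom 𝕜 r
  let φ : RingQuot r →ₐ[𝕜] Module.End 𝕜 ({w // Avoids F w} →₀ 𝕜) :=
    RingQuot.liftAlgHom 𝕜 ⟨wordAction 𝕜 F, fun x y h => by
      obtain ⟨f, hf, rfl, rfl⟩ := h₁ x y h
      rw [wordAction_eq_zero hf, map_zero]⟩
  have hφ : ∀ x, φ (π x) = wordAction 𝕜 F x := fun x =>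
    RingQuot.liftAlgHom_mkAlgHom_apply 𝕜 _ _ x
  have hnil : Avoids F [] := fun f hf h => hF (by rwa [List.infix_nil.1 h] at hf)
  refine ⟨Module.Basis.mk (v := fun w : {w // Avoids F w} => π (nilHeckeMonomial 𝕜 w.1)) ?_ ?_⟩
  -- Acting on the empty word sends each surviving monomial to its own basis vector, whence
  -- independence.
  · let ε : RingQuot r →ₗ[𝕜] ({w // Avoids F w} →₀ 𝕜) :=
      (LinearMap.applyₗ (wordVector 𝕜 F [])).comp φ.toLinearMap
    refine LinearIndependent.of_comp ε ?_
    have : (ε ∘ fun w : {w // Avoids F w} => π (nilHeckeMonomial 𝕜 w.1)) =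
        fun w => Finsupp.single w 1 := by
      funext w
      have h := wordAction_monomial (𝕜 := 𝕜) F w.1 []
      rw [List.append_nil] at h
      change φ (π _) (wordVector 𝕜 F []) = _
      rw [hφ, h, wordVector, dif_pos w.2]
    rw [this]
    exact Finsupp.linearIndependent_single_one 𝕜 _
  · rintro x -
    obtain ⟨x, rfl⟩ := RingQuot.mkAlgHom_surjective 𝕜 r x
    have hx : x ∈ Submodule.span 𝕜
        (Set.range (nilHeckeMonomial 𝕜 : List I → FreeAlgebra 𝕜 I)) := by
      rw [span_nilHeckeMonomial]; trivial
    induction hx using Submodule.span_induction with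
    | zero => rw [map_zero]; exact Submodule.zero_mem _
    | add a b _ _ ha hb => rw [map_add]; exact Submodule.add_mem _ ha hb
    | smul c a _ ha => rw [map_smul]; exact Submodule.smul_mem _ _ ha
    | mem x hx =>
      obtain ⟨w, rfl⟩ := hx
      by_cases hw : Avoids F w
      · exact Submodule.subset_span ⟨⟨w, hw⟩, rfl⟩
      · simp only [Avoids, not_forall, not_not] at hw
        obtain ⟨f, hf, s, t, rfl⟩ := hw
        have h0 : π (nilHeckeMonomial 𝕜 f) = 0 := by
          rw [← map_zero π]; exact RingQuot.mkAlgHom_rel 𝕜 (h₂ f hf)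
        change π _ ∈ _
        rw [nilHeckeMonomial_append, nilHeckeMonomial_append, map_mul, map_mul, h0, mul_zero,
          zero_mul]
        exact Submodule.zero_mem _

end MonomialAlgebra

/-! ### The nil-Hecke algebra without braid relations is monomial -/

/-- The words set equal to zero in the nil-Hecke algebra without braid relations. -/
def CoxeterMatrix.forbiddenWords {I : Type*} (M : CoxeterMatrix I) (d : I → ℕ) : Set (List I) :=
  {w | (∃ i, w = List.replicate (d i) i) ∨
    ∃ i j, i ≠ j ∧ M i j ≠ 0 ∧ w = CoxeterSystem.braidWord M i j}

theorem CoxeterMatrix.braidIndexLT_eq_empty {I : Type*} (M : CoxeterMatrix I) {k : ℕ}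
    (hk : k ≤ 2) : M.braidIndexLT k = ∅ := by
  rw [Set.eq_empty_iff_forall_notMem]
  rintro p ⟨i, j, -, hij, h0, h1⟩
  have := M.off_diagonal i j hij
  omega

theorem mem_braidIndex_iff {I : Type*} {M : CoxeterMatrix I} {i j : I} :
    s(i, j) ∈ M.braidIndex ↔ i ≠ j ∧ M i j ≠ 0 := by
  constructor
  · rintro ⟨a, b, h, hab, hM⟩
    rcases Sym2.eq_iff.1 h with ⟨rfl, rfl⟩ | ⟨rfl, rfl⟩
    · exact ⟨hab, hM⟩
    · exact ⟨hab.symm, by rwa [M.symmetric]⟩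
  · rintro ⟨h, hM⟩
    exact ⟨i, j, rfl, h, hM⟩

/-- With `J₀` empty no relation equates two nonzero words. The bound on `d` and `M i j ≠ 0` keep the
empty word from being forbidden. -/
theorem exists_basis_nilHecke_empty (𝕜 : Type*) [CommRing 𝕜] {I : Type*} (M : CoxeterMatrix I)
    (d : I → ℕ) (hd : ∀ i, 2 ≤ d i) :
    Nonempty (Module.Basis {w // Avoids (M.forbiddenWords d) w} 𝕜 (NilHecke 𝕜 M d ∅)) := by
  have hrep : ∀ i, nilHeckeMonomial 𝕜 (List.replicate (d i) i) = FreeAlgebra.ι 𝕜 i ^ d i := by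
    intro i; simp [nilHeckeMonomial]
  refine exists_basis_monomialAlgebra ?_ ?_ ?_
  · rintro (⟨i, h⟩ | ⟨i, j, -, h0, h⟩)
    · have := congrArg List.length h
      have := hd i
      simp at *; omega
    · have := congrArg List.length h
      simp at this; exact h0 this.symm
  · intro x y h
    cases h with
    | order i => exact ⟨_, Or.inl ⟨i, rfl⟩, (hrep i).symm, rfl⟩
    | braid i j h h₀ => exact absurd h₀ (Set.notMem_empty _)
    | vanish i j h h₀ =>
      exact ⟨_, Or.inr ⟨i, j, (mem_braidIndex_iff.1 h).1, (mem_braidIndex_iff.1 h).2, rfl⟩, rfl, rfl⟩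
  · rintro f (⟨i, rfl⟩ | ⟨i, j, hij, h0, rfl⟩)
    · rw [hrep]; exact .order i
    · exact .vanish i j (mem_braidIndex_iff.2 ⟨hij, h0⟩) (Set.notMem_empty _)

theorem SimpleGraph.Walk.head?_support {V : Type*} {G : SimpleGraph V} {x y : V}
    (p : G.Walk x y) : p.support.head? = some x := by
  cases p <;> simp

/-! ### Words in a rooted forest with jumps between roots -/

section ReducedWords

variable {I : Type*}

/-- A forest `G`, the function `ρ` that sends a vertex to the root of its tree, and a function `σ`
that sends roots to roots. -/
structure IsRootedForest (G : SimpleGraph I) (ρ σ : I → I) : Prop where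
  acyclic : G.IsAcyclic
  reachable_root : ∀ x, G.Reachable x (ρ x)
  root_eq : ∀ {x y}, G.Reachable x y → ρ x = ρ y
  root_map : ∀ {x}, ρ x = x → ρ (σ x) = σ x

/-- Words in which each step is an edge of `G` or leads from a root `i` to `σ i`, and in which no
edge is followed by its reverse. -/
def ReducedWord (G : SimpleGraph I) (ρ σ : I → I) : List I → Prop
  | [] => True
  | [_] => True
  | i :: j :: t => ((G.Adj i j ∧ t.head? ≠ some i) ∨ (ρ i = i ∧ j = σ i)) ∧
      ReducedWord G ρ σ (j :: t)

open Classical in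
/-- The number of steps of a word that are not edges of `G`. -/
noncomputable def jumpCount (G : SimpleGraph I) : List I → ℕ
  | [] => 0
  | [_] => 0
  | i :: j :: t => (if G.Adj i j then 0 else 1) + jumpCount G (j :: t)

/-- `JumpWord G ρ σ n x y w`: the word `w` runs from `x` to `y` along `n + 1` paths of `G`; the end
of each path but the last is a root, which `σ` maps to the start of the next path. -/
inductive JumpWord (G : SimpleGraph I) (ρ σ : I → I) : ℕ → I → I → List I → Prop
  | path {x y : I} (p : G.Walk x y) (hp : p.IsPath) : JumpWord G ρ σ 0 x y p.support
  | jump {n : ℕ} {x r y : I} {w : List I} (p : G.Walk x r) (hp : p.IsPath) (hr : ρ r = r)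
      (h : JumpWord G ρ σ n (σ r) y w) : JumpWord G ρ σ (n + 1) x y (p.support ++ w)

variable {G : SimpleGraph I} {ρ σ : I → I}

theorem IsRootedForest.root_root (h : IsRootedForest G ρ σ) (x : I) : ρ (ρ x) = ρ x :=
  (h.root_eq (h.reachable_root x)).symm

/-- Adjacent vertices have the same root, so two adjacent roots would coincide. Hence no step is
both an edge and a jump. -/
theorem IsRootedForest.not_adj_map (h : IsRootedForest G ρ σ) {x : I} (hx : ρ x = x) :
    ¬ G.Adj x (σ x) := fun hadj => by
  have := h.root_eq hadj.reachable
  rw [hx, h.root_map hx] at this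
  exact hadj.ne this

theorem IsRootedForest.reachable_iff (h : IsRootedForest G ρ σ) {x y : I} :
    G.Reachable x y ↔ ρ x = ρ y :=
  ⟨h.root_eq, fun e => (h.reachable_root x).trans (e ▸ (h.reachable_root y).symm)⟩

/-- Being reduced is a condition on factors of length two and three, which makes it comparable with
the short forbidden words. -/
theorem reducedWord_iff (h : IsRootedForest G ρ σ) {w : List I} :
    ReducedWord G ρ σ w ↔
      (∀ i j, ¬ (G.Adj i j ∨ (ρ i = i ∧ j = σ i)) → ¬ [i, j] <:+: w) ∧
      ∀ i j, G.Adj i j → ¬ [i, j, i] <:+: w := by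
  induction w with
  | nil => simp [ReducedWord]
  | cons a w ih =>
    cases w with
    | nil => simp [ReducedWord, List.infix_cons_iff]
    | cons b t =>
      rw [ReducedWord, ih]
      constructor
      · rintro ⟨h₁, h₂, h₃⟩
        constructor
        · intro i j hij hw
          rw [List.infix_cons_iff] at hw
          rcases hw with hw | hw
          · simp only [List.cons_prefix_cons, List.nil_prefix, and_true] at hw
            obtain ⟨rfl, rfl⟩ := hw
            tauto
          · exact h₂ i j hij hw
        · intro i j hij hw
          rw [List.infix_cons_iff] at hw
          rcases hw with hw | hw
          · simp only [List.cons_prefix_cons] at hw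
            obtain ⟨rfl, rfl, u, rfl⟩ := hw
            rcases h₁ with h₁ | ⟨h₁, rfl⟩
            · exact h₁.2 (by simp)
            · exact h.not_adj_map h₁ hij
          · exact h₃ i j hij hw
      · rintro ⟨h₂, h₃⟩
        refine ⟨?_, fun i j hij hw => h₂ i j hij (hw.trans (List.suffix_cons _ _).isInfix),
          fun i j hij hw => h₃ i j hij (hw.trans (List.suffix_cons _ _).isInfix)⟩
        by_cases hab : G.Adj a b
        · refine Or.inl ⟨hab, fun ht => h₃ a b hab (List.IsPrefix.isInfix ?_)⟩
          cases t with
          | nil => simp at ht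
          | cons c t => simp at ht; simp [ht]
        · by_contra hc
          refine h₂ a b (by tauto) (List.IsPrefix.isInfix ?_)
          simp

theorem JumpWord.head?_eq {n : ℕ} {x y : I} {w : List I} (h : JumpWord G ρ σ n x y w) :
    w.head? = some x := by
  cases h with
  | path p hp => cases p <;> simp
  | jump p hp hr h => cases p <;> simp

theorem JumpWord.getLast?_eq {n : ℕ} {x y : I} {w : List I} (h : JumpWord G ρ σ n x y w) :
    w.getLast? = some y := by
  induction h with
  | path p hp => rw [List.getLast?_eq_some_getLast p.support_ne_nil]; simp
  | jump p hp hr h ih => simp [List.getLast?_append, ih]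

theorem JumpWord.reducedWord (hF : IsRootedForest G ρ σ) {n : ℕ} {x y : I} {w : List I}
    (h : JumpWord G ρ σ n x y w) : ReducedWord G ρ σ w ∧ jumpCount G w = n := by
  induction h with
  | path p hp =>
    induction p with
    | nil => simp [ReducedWord, jumpCount]
    | @cons i j y hij p ih =>
      rw [SimpleGraph.Walk.cons_isPath_iff] at hp
      have ih := ih hp.1
      have hi := hp.2
      rw [SimpleGraph.Walk.support_cons]
      rw [← SimpleGraph.Walk.cons_tail_support] at ih hi ⊢
      refine ⟨⟨Or.inl ⟨hij, fun ht => hi ?_⟩, ih.1⟩, ?_⟩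
      · exact List.mem_cons_of_mem _ (List.mem_of_mem_head? ht)
      · simpa [jumpCount, hij] using ih.2
  | @jump n x r y w p hp hr h ih =>
    obtain ⟨t, rfl⟩ : ∃ t, w = σ r :: t := by
      have := h.head?_eq
      cases w with
      | nil => simp at this
      | cons a t => simp at this; exact ⟨t, by rw [this]⟩
    clear h
    induction p with
    | nil =>
      simp only [SimpleGraph.Walk.support_nil, List.singleton_append]
      refine ⟨⟨Or.inr ⟨hr, rfl⟩, ih.1⟩, ?_⟩
      simp [jumpCount, hF.not_adj_map hr, ih.2, Nat.add_comm]
    | @cons i j r hij p ih' =>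
      rw [SimpleGraph.Walk.cons_isPath_iff] at hp
      have ih' := ih' hp.1 hr ih
      have hi := hp.2
      rw [SimpleGraph.Walk.support_cons]
      -- Turning back at the junction would mean `σ r = i`, so that `r` and `σ r` would be adjacent.
      have hne : ((p.support ++ σ r :: t).tail).head? ≠ some i := by
        cases p with
        | nil =>
          simp only [SimpleGraph.Walk.support_nil, List.singleton_append, List.tail_cons,
            List.head?_cons, ne_eq, Option.some.injEq]
          rintro rfl
          exact hF.not_adj_map hr hij.symm
        | cons h' p =>
          intro hc
          rw [SimpleGraph.Walk.support_cons, List.cons_append, List.tail_cons, List.head?_append,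
            SimpleGraph.Walk.head?_support] at hc
          obtain rfl := Option.some.inj hc
          exact hi (List.mem_cons_of_mem _ p.start_mem_support)
      rw [← SimpleGraph.Walk.cons_tail_support] at ih' hne ⊢
      rw [List.cons_append] at ih' hne
      refine ⟨⟨Or.inl ⟨hij, hne⟩, ih'.1⟩, ?_⟩
      simp only [List.cons_append, jumpCount, hij, if_true, ih'.2, Nat.zero_add]

/-- Paths in a forest are determined by their ends, and a path that precedes a jump must end at the
root of its tree. -/
theorem JumpWord.unique (hF : IsRootedForest G ρ σ) {n : ℕ} {x y : I} {w w' : List I}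
    (h : JumpWord G ρ σ n x y w) (h' : JumpWord G ρ σ n x y w') : w = w' := by
  induction h generalizing w' with
  | @path x y p hp =>
    cases h' with
    | path q hq =>
      have := hF.acyclic.subsingleton_path x y
      exact congrArg (fun p : G.Path x y => p.1.support) (Subsingleton.elim ⟨p, hp⟩ ⟨q, hq⟩)
  | @jump n x r y w p hp hr h ih =>
    cases h' with
    | @jump _ _ r' _ w' q hq hr' h' =>
      obtain rfl : r = r' := by
        rw [← hr, ← hr', ← hF.root_eq p.reachable, ← hF.root_eq q.reachable]
      have := hF.acyclic.subsingleton_path x r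
      rw [ih h', congrArg (fun p : G.Path x r => p.1.support)
        (Subsingleton.elim ⟨p, hp⟩ ⟨q, hq⟩)]

/-- A path stays in one tree and a jump applies `σ` to the root; conversely `exists_jumpWord` walks
to the root and jumps. -/
theorem JumpWord.iterate_root (hF : IsRootedForest G ρ σ) {n : ℕ} {x y : I} {w : List I}
    (h : JumpWord G ρ σ n x y w) : σ^[n] (ρ x) = ρ y := by
  induction h with
  | path p hp => exact hF.root_eq p.reachable
  | jump p hp hr h ih =>
    rw [Function.iterate_succ_apply, hF.root_eq p.reachable, hr, ← ih, hF.root_map hr]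

theorem exists_jumpWord (hF : IsRootedForest G ρ σ) {n : ℕ} {x y : I}
    (h : σ^[n] (ρ x) = ρ y) : ∃ w, JumpWord G ρ σ n x y w := by
  induction n generalizing x with
  | zero =>
    obtain ⟨p, hp⟩ := (hF.reachable_iff.2 h).exists_isPath
    exact ⟨_, .path p hp⟩
  | succ n ih =>
    obtain ⟨p, hp⟩ := (hF.reachable_root x).exists_isPath
    rw [Function.iterate_succ_apply] at h
    obtain ⟨w, hw⟩ := ih (x := σ (ρ x)) (by rwa [hF.root_map (hF.root_root x)])
    exact ⟨_, .jump p hp (hF.root_root x) hw⟩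

/-- In a forest a neighbour of the start of a path lies on the path only as its second vertex, so
excluding immediate reversal is enough. -/
theorem isPath_cons_of_head?_ne (hG : G.IsAcyclic) {i j y : I} (hij : G.Adj i j)
    {p : G.Walk j y} (hp : p.IsPath) (hne : p.support.tail.head? ≠ some i) :
    (p.cons hij).IsPath := by
  refine hp.cons fun hi => hne ?_
  have := hG.eq_snd_of_adj_start hp hij.symm hi
  cases p with
  | nil => simp at hi; exact absurd hi hij.ne
  | cons h p =>
    rw [this, SimpleGraph.Walk.support_cons, List.tail_cons, SimpleGraph.Walk.head?_support]
    simp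

/-- A letter prepended along an edge lengthens the first path; one prepended by a jump opens a new
path of length zero. -/
theorem exists_jumpWord_of_reducedWord (hF : IsRootedForest G ρ σ) {w : List I} (hne : w ≠ [])
    (hw : ReducedWord G ρ σ w) : ∃ n x y, JumpWord G ρ σ n x y w := by
  induction w with
  | nil => exact absurd rfl hne
  | cons i w ih =>
    cases w with
    | nil => exact ⟨0, i, i, .path .nil .nil⟩
    | cons j t =>
      obtain ⟨n, x, y, h⟩ := ih (by simp) hw.2
      obtain rfl : j = x := by simpa using h.head?_eq
      rcases hw.1 with ⟨hij, ht⟩ | ⟨hi, rfl⟩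
      · generalize hs : j :: t = s at h
        cases h with
        | path p hp =>
          refine ⟨0, i, y, ?_⟩
          have := JumpWord.path (ρ := ρ) (σ := σ) _
            (isPath_cons_of_head?_ne hF.acyclic hij hp (by rwa [← hs]))
          rwa [SimpleGraph.Walk.support_cons] at this
        | @jump n _ r _ w p hp hr h =>
          have hp' : (p.cons hij).IsPath := by
            refine isPath_cons_of_head?_ne hF.acyclic hij hp fun hc => ht ?_
            rw [← SimpleGraph.Walk.cons_tail_support, List.cons_append, List.cons.injEq] at hs
            rw [hs.2, List.head?_append, hc]
            rfl
          have := JumpWord.jump (p.cons hij) hp' hr h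
          rw [SimpleGraph.Walk.support_cons, List.cons_append] at this
          exact ⟨_, _, _, this⟩
      · exact ⟨n + 1, i, y, .jump (.nil : G.Walk i i) .nil hi h⟩

theorem jumpCount_le_of_infix {v w : List I} (h : v <:+: w) :
    jumpCount G v ≤ jumpCount G w := by
  have hcons : ∀ (a : I) (u : List I), jumpCount G u ≤ jumpCount G (a :: u) := by
    intro a u
    cases u <;> simp [jumpCount]
  have hpre : ∀ u s : List I, jumpCount G u ≤ jumpCount G (u ++ s) := by
    intro u s
    induction u with
    | nil => simp [jumpCount]
    | cons a u ih =>
      cases u with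
      | nil => simp [jumpCount]
      | cons b u => simpa [jumpCount] using ih
  obtain ⟨s, t, rfl⟩ := h
  rw [List.append_assoc]
  induction s with
  | nil => exact hpre _ _
  | cons a s ih => exact ih.trans (hcons a _)

theorem jumpCount_iterate (hF : IsRootedForest G ρ σ) {r : I} (hr : ρ r = r) (n : ℕ) :
    jumpCount G (List.iterate σ r (n + 1)) = n := by
  induction n generalizing r with
  | zero => simp [List.iterate, jumpCount]
  | succ n ih =>
    have := ih (hF.root_map hr)
    rw [List.iterate] at this ⊢
    rw [List.iterate, jumpCount, if_neg (hF.not_adj_map hr), this, Nat.add_comm]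

/-- A path between roots is trivial, since a tree has only one root. After the first jump the others
therefore follow at once. -/
theorem JumpWord.iterate_prefix (hF : IsRootedForest G ρ σ) {n k : ℕ} {r y : I} {w : List I}
    (h : JumpWord G ρ σ n r y w) (hr : ρ r = r) (hk : k ≤ n) :
    List.iterate σ r (k + 1) <+: w := by
  induction k generalizing n r w with
  | zero =>
    have := h.head?_eq
    cases w with
    | nil => simp at this
    | cons a w => simp at this; simp [List.iterate, this]
  | succ k ih =>
    cases h with
    | path => omega
    | @jump n _ r' _ w p hp hr' h =>
      obtain rfl : r = r' := by rw [← hr, ← hr', hF.root_eq p.reachable]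
      obtain rfl := (SimpleGraph.Walk.isPath_iff_nil.1 hp).eq_nil
      have := ih h (hF.root_map hr) (by omega)
      rw [List.iterate]
      simpa using this

/-- All jumps are consecutive, so a run of `k` jumps exists as soon as there are `k` of them. For `k
= 0` this would fail: a word need not meet a root. -/
theorem JumpWord.exists_iterate_infix_iff (hF : IsRootedForest G ρ σ) {n k : ℕ} {x y : I}
    {w : List I} (h : JumpWord G ρ σ n x y w) (hk : 1 ≤ k) :
    (∃ r, ρ r = r ∧ List.iterate σ r (k + 1) <:+: w) ↔ k ≤ n := by
  constructor
  · rintro ⟨r, hr, hw⟩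
    have := jumpCount_le_of_infix (G := G) hw
    rwa [jumpCount_iterate hF hr, (h.reducedWord hF).2] at this
  · intro hkn
    cases h with
    | path => omega
    | @jump n _ r _ w p hp hr h =>
      refine ⟨r, hr, ?_⟩
      -- Shrinks the first path to its last vertex, so that the word starts at a root.
      have h' : JumpWord G ρ σ (n + 1) r y ([r] ++ w) := .jump (.nil : G.Walk r r) .nil hr h
      refine (h'.iterate_prefix hF hr hkn).isInfix.trans (List.IsSuffix.isInfix ?_)
      refine ⟨p.support.dropLast, ?_⟩
      rw [← List.append_assoc]
      congr 1
      conv_rhs => rw [← List.dropLast_append_getLast p.support_ne_nil]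
      simp

/-- Reduced words without runs of `K` jumps are classified by their ends and their number of
jumps. -/
theorem nonempty_equiv_reducedWord (hF : IsRootedForest G ρ σ) {F : Set (List I)} {K : ℕ}
    (hK : 1 ≤ K)
    (h : ∀ w, Avoids F w ↔
      ReducedWord G ρ σ w ∧ ∀ r, ρ r = r → ¬ List.iterate σ r (K + 1) <:+: w) :
    Nonempty (Option {t : (I × I) × Fin K // σ^[t.2] (ρ t.1.1) = ρ t.1.2} ≃
      {w // Avoids F w}) := by
  have hav : ∀ {n x y w}, JumpWord G ρ σ n x y w → (Avoids F w ↔ n < K) := by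
    intro n x y w hw
    rw [h, and_iff_right (hw.reducedWord hF).1, ← not_le, ← hw.exists_iterate_infix_iff hF hK]
    push Not
    rfl
  have hnil : Avoids F [] := by
    rw [h]
    exact ⟨trivial, fun r _ h => by simp [List.iterate] at h⟩
  choose f hf using fun t : {t : (I × I) × Fin K // σ^[t.2] (ρ t.1.1) = ρ t.1.2} =>
    exists_jumpWord hF t.2
  -- `none` stands for the empty word, the summand 1 in the ranks.
  let g : Option {t : (I × I) × Fin K // σ^[t.2] (ρ t.1.1) = ρ t.1.2} → {w // Avoids F w} :=
    fun o => o.elim ⟨[], hnil⟩ fun t => ⟨f t, (hav (hf t)).2 t.1.2.2⟩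
  refine ⟨Equiv.ofBijective g ⟨?_, ?_⟩⟩
  · have hne : ∀ t, f t ≠ [] := fun t e => by
      have := (hf t).head?_eq
      simp [e] at this
    rintro (_ | s) (_ | t) hst
    · rfl
    · exact absurd (congrArg Subtype.val hst).symm (hne t)
    · exact absurd (congrArg Subtype.val hst) (hne s)
    · have e : f s = f t := congrArg Subtype.val hst
      have h₁ := (hf s).head?_eq
      have h₂ := (hf s).getLast?_eq
      have h₃ := ((hf s).reducedWord hF).2
      rw [e, (hf t).head?_eq] at h₁
      rw [e, (hf t).getLast?_eq] at h₂
      rw [e, ((hf t).reducedWord hF).2] at h₃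
      congr 1
      ext
      · exact (Option.some.inj h₁).symm
      · exact (Option.some.inj h₂).symm
      · exact h₃.symm
  · rintro ⟨w, hw⟩
    by_cases hne : w = []
    · subst hne; exact ⟨none, rfl⟩
    · obtain ⟨n, x, y, hj⟩ := exists_jumpWord_of_reducedWord hF hne ((h w).1 hw).1
      let t : {t : (I × I) × Fin K // σ^[t.2] (ρ t.1.1) = ρ t.1.2} :=
        ⟨((x, y), ⟨n, (hav hj).1 hw⟩), hj.iterate_root hF⟩
      exact ⟨some t, Subtype.ext ((hf t).unique hF hj)⟩

end ReducedWords

/-! ### The simply laced tree -/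

section TreeCases

variable {I : Type*}

theorem CoxeterMatrix.mem_multipleEdges_iff {M : CoxeterMatrix I} {i j : I} :
    s(i, j) ∈ M.multipleEdges ↔ i ≠ j ∧ (4 ≤ M i j ∨ M i j = 0) := by
  constructor
  · rintro ⟨a, b, h, hab, hM⟩
    rcases Sym2.eq_iff.1 h with ⟨rfl, rfl⟩ | ⟨rfl, rfl⟩
    · exact ⟨hab, hM⟩
    · exact ⟨hab.symm, by rwa [M.symmetric]⟩
  · rintro ⟨h, hM⟩
    exact ⟨i, j, rfl, h, hM⟩

theorem CoxeterMatrix.eq_two_or_three {M : CoxeterMatrix I} {i j : I} (hij : i ≠ j)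
    (h : s(i, j) ∉ M.multipleEdges) : M i j = 2 ∨ M i j = 3 := by
  have h1 := M.off_diagonal i j hij
  rw [mem_multipleEdges_iff] at h
  have : ¬ (4 ≤ M i j ∨ M i j = 0) := fun hc => h ⟨hij, hc⟩
  omega

theorem braidWord_of_eq_two {M : CoxeterMatrix I} {i j : I} (h : M i j = 2) :
    CoxeterSystem.braidWord M i j = [i, j] := by
  rw [CoxeterSystem.braidWord, h]; rfl

theorem braidWord_of_eq_three {M : CoxeterMatrix I} {i j : I} (h : M i j = 3) :
    CoxeterSystem.braidWord M i j = [j, i, j] := by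
  rw [CoxeterSystem.braidWord, h]; rfl

/-- `alternatingWord i j m` ends in `j`, so its first letter depends on the parity of `m`. -/
theorem alternatingWord_eq_iterate {σ : I → I} {i j : I} (hi : σ i = j) (hj : σ j = i) (m : ℕ) :
    CoxeterSystem.alternatingWord i j m = List.iterate σ (if Even m then i else j) m := by
  induction m with
  | zero => simp [CoxeterSystem.alternatingWord, List.iterate]
  | succ m ih =>
    rw [CoxeterSystem.alternatingWord_succ', ih, List.iterate]
    by_cases hm : Even m <;> simp [Nat.even_add_one, hm, hi, hj]

theorem iterate_id_eq_replicate (i : I) (n : ℕ) : List.iterate id i n = List.replicate n i := by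
  induction n with
  | zero => rfl
  | succ n ih => rw [List.iterate, id, ih, List.replicate_succ]

/-- A tree may be rooted anywhere; with `σ = id` a jump repeats the root. -/
theorem isRootedForest_const {G : SimpleGraph I} (hG : G.IsTree) (i : I) :
    IsRootedForest G (Function.const I i) id :=
  ⟨hG.isAcyclic, fun _ => hG.connected.preconnected _ _, fun _ => rfl, fun h => h⟩

theorem CoxeterMatrix.IsSimplyLacedTree.avoids_iff {M : CoxeterMatrix I} {d : I → ℕ}
    (hM : M.IsSimplyLacedTree d) (hd : ∀ i, 2 ≤ d i) {i₀ : I} (h₀ : ∀ i, i ≠ i₀ → d i = 2)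
    (w : List I) :
    Avoids (M.forbiddenWords d) w ↔
      ReducedWord M.coxeterGraph (Function.const I i₀) id w ∧
      ∀ r, Function.const I i₀ r = r → ¬ List.iterate id r (d i₀ - 1 + 1) <:+: w := by
  have hM' : ∀ i j, i ≠ j → M i j = 2 ∨ M i j = 3 := fun i j hij =>
    eq_two_or_three hij (by rw [show M.multipleEdges = ∅ from hM.2.1]; exact Set.notMem_empty _)
  -- The word of `d i₀` equal letters is a run of `K = d i₀ - 1` jumps.
  have hd₀ : d i₀ - 1 + 1 = d i₀ := by have := hd i₀; omega
  rw [reducedWord_iff (isRootedForest_const hM.1 i₀), hd₀]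
  simp only [iterate_id_eq_replicate, Function.const_apply, id]
  constructor
  · intro h
    refine ⟨⟨fun i j hij => ?_, fun i j hij => ?_⟩, ?_⟩
    · rw [not_or] at hij
      by_cases e : i = j
      · subst e
        refine h _ (Or.inl ⟨i, ?_⟩)
        rw [h₀ i (fun e => hij.2 ⟨e.symm, rfl⟩)]
        rfl
      · have h2 : M i j = 2 := by
          by_contra h2
          exact hij.1 ⟨e, h2⟩
        exact h _ (Or.inr ⟨i, j, e, by omega, (braidWord_of_eq_two h2).symm⟩)
    · have h3 : M j i = 3 := (hM' j i hij.1.symm).resolve_left hij.symm.2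
      exact h _ (Or.inr ⟨j, i, hij.1.symm, by omega, (braidWord_of_eq_three h3).symm⟩)
    · rintro _ rfl
      exact h _ (Or.inl ⟨i₀, rfl⟩)
  · rintro ⟨⟨h₁, h₂⟩, h₃⟩ f (⟨i, rfl⟩ | ⟨i, j, hij, -, rfl⟩)
    · by_cases e : i = i₀
      · subst e; exact h₃ _ rfl
      · rw [h₀ i e]
        refine h₁ i i ?_
        rintro (h | h)
        · exact h.ne rfl
        · exact e h.1.symm
    · rcases hM' i j hij with h | h
      · rw [braidWord_of_eq_two h]
        refine h₁ i j ?_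
        rintro (h' | h')
        · exact h'.2 h
        · exact hij h'.2.symm
      · rw [braidWord_of_eq_three h]
        exact h₂ j i ⟨hij.symm, by rw [M.symmetric]; omega⟩

/-! ### The tree with one multiple edge -/

open Classical in
/-- The end of the edge `{i, j}` that is reachable from a vertex without using this edge. -/
noncomputable def nearEnd (G : SimpleGraph I) (i j x : I) : I :=
  if (G.deleteEdges {s(i, j)}).Reachable i x then i else j

open Classical in
/-- The function that exchanges `i` and `j`. -/
noncomputable def otherEnd (i j x : I) : I := if x = i then j else i

theorem nearEnd_eq_or (G : SimpleGraph I) (i j x : I) :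
    nearEnd G i j x = i ∨ nearEnd G i j x = j := by
  unfold nearEnd; split <;> simp

theorem otherEnd_left (i j : I) : otherEnd i j i = j := if_pos rfl

theorem otherEnd_right {i j : I} (hij : i ≠ j) : otherEnd i j j = i := if_neg hij.symm

theorem not_reachable_deleteEdges {G : SimpleGraph I} (hG : G.IsAcyclic) {i j : I}
    (hij : G.Adj i j) : ¬ (G.deleteEdges {s(i, j)}).Reachable i j :=
  (SimpleGraph.isBridge_iff.1 (SimpleGraph.isAcyclic_iff_forall_adj_isBridge.1 hG hij))

theorem nearEnd_left (G : SimpleGraph I) (i j : I) : nearEnd G i j i = i :=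
  if_pos (SimpleGraph.Reachable.refl _)

theorem nearEnd_right {G : SimpleGraph I} (hG : G.IsAcyclic) {i j : I} (hij : G.Adj i j) :
    nearEnd G i j j = j := if_neg (not_reachable_deleteEdges hG hij)

theorem reachable_deleteEdges_or {G : SimpleGraph I} {i j x : I} (p : G.Walk x i) :
    (G.deleteEdges {s(i, j)}).Reachable i x ∨ (G.deleteEdges {s(i, j)}).Reachable j x := by
  induction p with
  | nil => exact Or.inl (SimpleGraph.Reachable.refl _)
  | @cons x y i h p ih =>
    by_cases e : s(x, y) = s(i, j)
    · rcases Sym2.eq_iff.1 e with ⟨rfl, -⟩ | ⟨rfl, -⟩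
      · exact Or.inl (SimpleGraph.Reachable.refl _)
      · exact Or.inr (SimpleGraph.Reachable.refl _)
    · have hyx : (G.deleteEdges {s(i, j)}).Reachable y x :=
        (SimpleGraph.Adj.reachable (SimpleGraph.deleteEdges_adj.2 ⟨h, e⟩)).symm
      exact ih.imp (fun h => h.trans hyx) fun h => h.trans hyx

/-- The edge is a bridge, and its ends serve as roots of the two remaining trees. A jump crosses the
deleted edge. -/
theorem isRootedForest_deleteEdges {G : SimpleGraph I} (hG : G.IsTree) {i j : I}
    (hij : G.Adj i j) :
    IsRootedForest (G.deleteEdges {s(i, j)}) (nearEnd G i j) (otherEnd i j) := by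
  refine ⟨hG.isAcyclic.anti (SimpleGraph.deleteEdges_le _), fun x => ?_, fun {x y} h => ?_,
    fun {x} hx => ?_⟩
  · unfold nearEnd
    split_ifs with h
    · exact h.symm
    · obtain ⟨p⟩ := hG.connected.preconnected x i
      exact ((reachable_deleteEdges_or p).resolve_left h).symm
  · unfold nearEnd
    have : (G.deleteEdges {s(i, j)}).Reachable i x ↔ (G.deleteEdges {s(i, j)}).Reachable i y :=
      ⟨fun h' => h'.trans h, fun h' => h'.trans h.symm⟩
    by_cases hx : (G.deleteEdges {s(i, j)}).Reachable i x
    · rw [if_pos hx, if_pos (this.1 hx)]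
    · rw [if_neg hx, if_neg fun hy => hx (this.2 hy)]
  · rcases nearEnd_eq_or G i j x with h | h <;> rw [hx] at h <;> subst h
    · rw [otherEnd_left, nearEnd_right hG.isAcyclic hij]
    · rw [otherEnd_right hij.ne, nearEnd_left]

theorem CoxeterMatrix.IsOneMultipleEdgeTree.ne {M : CoxeterMatrix I} {d : I → ℕ} {i₀ j₀ : I}
    (hM : M.IsOneMultipleEdgeTree d i₀ j₀) : i₀ ≠ j₀ := by
  have : s(i₀, j₀) ∈ M.multipleEdges := by rw [hM.2.1]; rfl
  exact (mem_multipleEdges_iff.1 this).1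

theorem CoxeterMatrix.IsOneMultipleEdgeTree.adj {M : CoxeterMatrix I} {d : I → ℕ} {i₀ j₀ : I}
    (hM : M.IsOneMultipleEdgeTree d i₀ j₀) : M.coxeterGraph.Adj i₀ j₀ :=
  ⟨hM.ne, by have := hM.2.2.1; omega⟩

/-- The two braid words of the multiple edge are the runs of `m - 1` jumps. All other forbidden
words have length two or three and express reducedness. -/
theorem CoxeterMatrix.IsOneMultipleEdgeTree.avoids_iff {M : CoxeterMatrix I} {d : I → ℕ}
    {i₀ j₀ : I} (hM : M.IsOneMultipleEdgeTree d i₀ j₀) (w : List I) :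
    Avoids (M.forbiddenWords d) w ↔
      ReducedWord (M.coxeterGraph.deleteEdges {s(i₀, j₀)}) (nearEnd M.coxeterGraph i₀ j₀)
        (otherEnd i₀ j₀) w ∧
      ∀ r, nearEnd M.coxeterGraph i₀ j₀ r = r →
        ¬ List.iterate (otherEnd i₀ j₀) r (M i₀ j₀ - 1 + 1) <:+: w := by
  have hne := hM.ne
  have hadj := hM.adj
  have h4 := hM.2.2.1
  have hl := otherEnd_left i₀ j₀
  have hr := otherEnd_right hne
  have hM' : ∀ i j, i ≠ j → s(i, j) ≠ s(i₀, j₀) → M i j = 2 ∨ M i j = 3 := fun i j hij h =>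
    eq_two_or_three hij (by rw [hM.2.1]; exact h)
  have hroot : ∀ i, nearEnd M.coxeterGraph i₀ j₀ i = i → i = i₀ ∨ i = j₀ := by
    intro i hi
    have := nearEnd_eq_or M.coxeterGraph i₀ j₀ i
    rwa [hi] at this
  have hnl := nearEnd_left M.coxeterGraph i₀ j₀
  have hnr := nearEnd_right hM.1.isAcyclic hadj
  have hstep : ∀ i, nearEnd M.coxeterGraph i₀ j₀ i = i →
      s(i, otherEnd i₀ j₀ i) = s(i₀, j₀) := by
    intro i hi
    rcases hroot i hi with rfl | rfl
    · rw [hl]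
    · rw [hr, Sym2.eq_swap]
  have hbraid : ∀ i j, s(i, j) = s(i₀, j₀) → ∃ r, nearEnd M.coxeterGraph i₀ j₀ r = r ∧
      CoxeterSystem.braidWord M i j = List.iterate (otherEnd i₀ j₀) r (M i₀ j₀) := by
    intro i j hij
    rcases Sym2.eq_iff.1 hij with ⟨rfl, rfl⟩ | ⟨rfl, rfl⟩
    · exact ⟨if Even (M i j) then i else j, by split_ifs <;> assumption,
        alternatingWord_eq_iterate hl hr _⟩
    · rw [CoxeterSystem.braidWord, M.symmetric i j]
      exact ⟨if Even (M j i) then i else j, by split_ifs <;> assumption,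
        alternatingWord_eq_iterate hr hl _⟩
  have hiter : ∀ r, nearEnd M.coxeterGraph i₀ j₀ r = r → ∃ i j, i ≠ j ∧ M i j ≠ 0 ∧
      List.iterate (otherEnd i₀ j₀) r (M i₀ j₀) = CoxeterSystem.braidWord M i j := by
    intro r hr'
    have e₁ := alternatingWord_eq_iterate hl hr (M i₀ j₀)
    have e₂ := alternatingWord_eq_iterate hr hl (M i₀ j₀)
    have hs := M.symmetric i₀ j₀
    have b₁ : i₀ ≠ j₀ ∧ M i₀ j₀ ≠ 0 := ⟨hne, by omega⟩
    have b₂ : j₀ ≠ i₀ ∧ M j₀ i₀ ≠ 0 := ⟨hne.symm, by omega⟩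
    have e₃ : CoxeterSystem.braidWord M j₀ i₀ =
        CoxeterSystem.alternatingWord j₀ i₀ (M i₀ j₀) := by
      rw [CoxeterSystem.braidWord, hs]
    -- Exactly one of the two braid words starts at `r`; the parity of `m` decides which.
    by_cases hm : Even (M i₀ j₀) <;> simp only [hm, if_true, if_false] at e₁ e₂ <;>
      rcases hroot r hr' with rfl | rfl
    · exact ⟨_, _, b₁.1, b₁.2, e₁.symm⟩
    · exact ⟨_, _, b₂.1, b₂.2, by rw [e₃, e₂]⟩
    · exact ⟨_, _, b₂.1, b₂.2, by rw [e₃, e₂]⟩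
    · exact ⟨_, _, b₁.1, b₁.2, e₁.symm⟩
  rw [reducedWord_iff (isRootedForest_deleteEdges hM.1 hadj),
    show M i₀ j₀ - 1 + 1 = M i₀ j₀ by omega]
  simp only [SimpleGraph.deleteEdges_adj, Set.mem_singleton_iff]
  constructor
  · intro h
    refine ⟨⟨fun i j hij => ?_, fun i j hij => ?_⟩, fun r hr' => ?_⟩
    · by_cases e : i = j
      · subst e
        refine h _ (Or.inl ⟨i, ?_⟩)
        rw [hM.2.2.2 i]
        rfl
      · have hs : s(i, j) ≠ s(i₀, j₀) := by
          intro hs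
          refine hij (Or.inr ?_)
          rcases Sym2.eq_iff.1 hs with ⟨rfl, rfl⟩ | ⟨rfl, rfl⟩
          · exact ⟨hnl, hl.symm⟩
          · exact ⟨hnr, hr.symm⟩
        have h2 : M i j = 2 := by
          by_contra h2
          exact hij (Or.inl ⟨⟨e, h2⟩, hs⟩)
        exact h _ (Or.inr ⟨i, j, e, by omega, (braidWord_of_eq_two h2).symm⟩)
    · have h3 : M j i = 3 := (hM' j i hij.1.1.symm
        (by rw [Sym2.eq_swap]; exact hij.2)).resolve_left hij.1.symm.2
      exact h _ (Or.inr ⟨j, i, hij.1.1.symm, by omega, (braidWord_of_eq_three h3).symm⟩)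
    · exact h _ (Or.inr (hiter r hr'))
  · rintro ⟨⟨h₁, h₂⟩, h₃⟩ f (⟨i, rfl⟩ | ⟨i, j, hij, -, rfl⟩)
    · rw [hM.2.2.2 i]
      refine h₁ i i ?_
      rintro (h | h)
      · exact h.1.ne rfl
      · have := hstep i h.1
        rw [← h.2] at this
        rcases Sym2.eq_iff.1 this with ⟨rfl, rfl⟩ | ⟨rfl, rfl⟩ <;> exact hne rfl
    · by_cases hs : s(i, j) = s(i₀, j₀)
      · obtain ⟨r, hr', e⟩ := hbraid i j hs
        rw [e]
        exact h₃ r hr'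
      · rcases hM' i j hij hs with h | h
        · rw [braidWord_of_eq_two h]
          refine h₁ i j ?_
          rintro (h' | h')
          · exact h'.1.2 h
          · exact hs (by rw [h'.2]; exact hstep i h'.1)
        · rw [braidWord_of_eq_three h]
          exact h₂ j i ⟨⟨hij.symm, by rw [M.symmetric]; omega⟩, by rwa [Sym2.eq_swap]⟩

/-! ### Counting the surviving words -/

theorem CoxeterMatrix.IsSimplyLacedTree.finite_and_card [Fintype I] {M : CoxeterMatrix I}
    {d : I → ℕ} (hM : M.IsSimplyLacedTree d) (hd : ∀ i, 2 ≤ d i) {i₀ : I}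
    (h₀ : ∀ i, i ≠ i₀ → d i = 2) :
    Finite {w // Avoids (M.forbiddenWords d) w} ∧
      Nat.card {w // Avoids (M.forbiddenWords d) w} = Fintype.card I ^ 2 * (d i₀ - 1) + 1 := by
  have hK : 1 ≤ d i₀ - 1 := by have := hd i₀; omega
  obtain ⟨e⟩ := nonempty_equiv_reducedWord (isRootedForest_const hM.1 i₀) hK
    (hM.avoids_iff hd h₀)
  refine ⟨Finite.of_equiv _ e, ?_⟩
  rw [← Nat.card_congr e, Finite.card_option]
  simp only [Function.const_apply, Function.iterate_id, id]
  -- With a single root every triple `(x, y, n)` is admissible.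
  rw [Nat.card_congr (Equiv.subtypeUnivEquiv fun _ => trivial)]
  simp [sq]

theorem iterate_otherEnd_left {i j : I} (hij : i ≠ j) (n : ℕ) :
    (otherEnd i j)^[n] i = if Even n then i else j := by
  induction n with
  | zero => simp
  | succ n ih =>
    rw [Function.iterate_succ_apply', ih]
    by_cases hn : Even n <;> simp [Nat.even_add_one, hn, otherEnd_left, otherEnd_right hij]

theorem iterate_otherEnd_right {i j : I} (hij : i ≠ j) (n : ℕ) :
    (otherEnd i j)^[n] j = if Even n then j else i := by
  induction n with
  | zero => simp
  | succ n ih =>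
    rw [Function.iterate_succ_apply', ih]
    by_cases hn : Even n <;> simp [Nat.even_add_one, hn, otherEnd_left, otherEnd_right hij]

open Classical in
theorem sum_comp_eq_of_two_values [Fintype I] {i j : I} (hij : i ≠ j) {ρ : I → I}
    (hρ : ∀ x, ρ x = i ∨ ρ x = j) (f : I → ℕ) :
    ∑ x, f (ρ x) = Nat.card {x // ρ x = i} * f i + Nat.card {x // ρ x = j} * f j := by
  have : ∀ x, f (ρ x) = (if ρ x = i then f i else 0) + if ρ x = j then f j else 0 := by
    intro x
    rcases hρ x with h | h <;> simp [h, hij, hij.symm]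
  rw [Finset.sum_congr rfl fun x _ => this x, Finset.sum_add_distrib, ← Finset.sum_filter,
    ← Finset.sum_filter, Finset.sum_const, Finset.sum_const, Nat.card_eq_fintype_card,
    Nat.card_eq_fintype_card, Fintype.card_subtype, Fintype.card_subtype, smul_eq_mul, smul_eq_mul]

-- An even number of jumps joins vertices of the same tree, giving `a² + b²` pairs; an odd number
-- joins different trees, giving `2ab`.
open Classical in
theorem card_otherEnd_pairs [Fintype I] {i j : I} (hij : i ≠ j) {ρ : I → I}
    (hρ : ∀ x, ρ x = i ∨ ρ x = j) (K : ℕ) {a b : ℕ} (ha : Nat.card {x // ρ x = i} = a)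
    (hb : Nat.card {x // ρ x = j} = b) :
    Nat.card {t : (I × I) × Fin K // (otherEnd i j)^[t.2] (ρ t.1.1) = ρ t.1.2} =
      ∑ n ∈ Finset.range K, if Even n then a ^ 2 + b ^ 2 else 2 * (a * b) := by
  rw [Nat.card_eq_fintype_card, Fintype.card_subtype, Finset.card_filter, Fintype.sum_prod_type,
    Finset.sum_comm, Finset.sum_range]
  refine Finset.sum_congr rfl fun n _ => ?_
  rw [Fintype.sum_prod_type]
  rw [sum_comp_eq_of_two_values hij hρ fun u =>
    ∑ y, if (otherEnd i j)^[n] u = ρ y then 1 else 0]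
  rw [sum_comp_eq_of_two_values hij hρ fun v => if (otherEnd i j)^[n] i = v then 1 else 0]
  rw [sum_comp_eq_of_two_values hij hρ fun v => if (otherEnd i j)^[n] j = v then 1 else 0]
  rw [iterate_otherEnd_left hij, iterate_otherEnd_right hij, ha, hb]
  by_cases hn : Even (n : ℕ) <;> simp [hn, hij, hij.symm] <;> ring

theorem CoxeterMatrix.IsOneMultipleEdgeTree.branchSize_left {M : CoxeterMatrix I}
    {d : I → ℕ} {i₀ j₀ : I} (hM : M.IsOneMultipleEdgeTree d i₀ j₀) :
    Nat.card {x // nearEnd M.coxeterGraph i₀ j₀ x = i₀} = M.branchSize i₀ j₀ := by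
  rw [branchSize, ← Nat.card_coe_set_eq]
  refine Nat.card_congr (Equiv.subtypeEquivRight fun x => ?_)
  rw [SimpleGraph.ConnectedComponent.mem_supp_iff, SimpleGraph.ConnectedComponent.eq,
    (isRootedForest_deleteEdges hM.1 hM.adj).reachable_iff, nearEnd_left]

theorem CoxeterMatrix.IsOneMultipleEdgeTree.branchSize_right {M : CoxeterMatrix I}
    {d : I → ℕ} {i₀ j₀ : I} (hM : M.IsOneMultipleEdgeTree d i₀ j₀) :
    Nat.card {x // nearEnd M.coxeterGraph i₀ j₀ x = j₀} = M.branchSize j₀ i₀ := by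
  rw [branchSize, ← Nat.card_coe_set_eq, Sym2.eq_swap]
  refine Nat.card_congr (Equiv.subtypeEquivRight fun x => ?_)
  rw [SimpleGraph.ConnectedComponent.mem_supp_iff, SimpleGraph.ConnectedComponent.eq,
    (isRootedForest_deleteEdges hM.1 hM.adj).reachable_iff, nearEnd_right hM.1.isAcyclic hM.adj]

theorem CoxeterMatrix.IsOneMultipleEdgeTree.branchSize_add [Fintype I] {M : CoxeterMatrix I}
    {d : I → ℕ} {i₀ j₀ : I} (hM : M.IsOneMultipleEdgeTree d i₀ j₀) :
    M.branchSize i₀ j₀ + M.branchSize j₀ i₀ = Fintype.card I := by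
  have := sum_comp_eq_of_two_values hM.ne (nearEnd_eq_or M.coxeterGraph i₀ j₀) fun _ => 1
  simpa [hM.branchSize_left, hM.branchSize_right] using this.symm

theorem CoxeterMatrix.IsOneMultipleEdgeTree.finite_and_card [Fintype I] {M : CoxeterMatrix I}
    {d : I → ℕ} {i₀ j₀ : I} (hM : M.IsOneMultipleEdgeTree d i₀ j₀) :
    Finite {w // Avoids (M.forbiddenWords d) w} ∧
      Nat.card {w // Avoids (M.forbiddenWords d) w} =
        (∑ n ∈ Finset.range (M i₀ j₀ - 1),
          if Even n then M.branchSize i₀ j₀ ^ 2 + M.branchSize j₀ i₀ ^ 2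
          else 2 * (M.branchSize i₀ j₀ * M.branchSize j₀ i₀)) + 1 := by
  have hK : 1 ≤ M i₀ j₀ - 1 := by have := hM.2.2.1; omega
  obtain ⟨e⟩ := nonempty_equiv_reducedWord (isRootedForest_deleteEdges hM.1 hM.adj) hK
    hM.avoids_iff
  refine ⟨Finite.of_equiv _ e, ?_⟩
  rw [← Nat.card_congr e, Finite.card_option, card_otherEnd_pairs hM.ne (nearEnd_eq_or _ _ _) _
    hM.branchSize_left hM.branchSize_right]

theorem sum_range_even_odd (q s t : ℕ) :
    ∑ n ∈ Finset.range (2 * q), (if Even n then s else t) = q * (s + t) := by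
  induction q with
  | zero => simp
  | succ q ih =>
    rw [show 2 * (q + 1) = 2 * q + 1 + 1 by ring, Finset.sum_range_succ, Finset.sum_range_succ, ih]
    simp
    ring

/-- For `m = 2q` the range `n < 2q - 1` consists of `q - 1` pairs contributing `(a + b)²` each, and
an unpaired even `n` contributing `a² + b² = (a + b)² - 2ab`. For odd `m` everything pairs up. -/
theorem CoxeterMatrix.IsOneMultipleEdgeTree.card_of_even [Fintype I] {M : CoxeterMatrix I}
    {d : I → ℕ} {i₀ j₀ : I} (hM : M.IsOneMultipleEdgeTree d i₀ j₀) (h : Even (M i₀ j₀)) :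
    (Nat.card {w // Avoids (M.forbiddenWords d) w} : ℚ) =
      1 / 2 * (M i₀ j₀ : ℚ) * (Fintype.card I : ℚ) ^ 2 + 1
        - 2 * (M.branchSize i₀ j₀ : ℚ) * (M.branchSize j₀ i₀ : ℚ) := by
  obtain ⟨q, hq⟩ := h
  have h4 := hM.2.2.1
  rw [hM.finite_and_card.2, ← hM.branchSize_add, show M i₀ j₀ - 1 = 2 * (q - 1) + 1 by omega,
    Finset.sum_range_succ, sum_range_even_odd, if_pos (by simp), hq]
  obtain ⟨q, rfl⟩ : ∃ k, q = k + 1 := ⟨q - 1, by omega⟩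
  rw [Nat.add_sub_cancel]
  push_cast
  ring

theorem CoxeterMatrix.IsOneMultipleEdgeTree.card_of_odd [Fintype I] {M : CoxeterMatrix I}
    {d : I → ℕ} {i₀ j₀ : I} (hM : M.IsOneMultipleEdgeTree d i₀ j₀) (h : Odd (M i₀ j₀)) :
    (Nat.card {w // Avoids (M.forbiddenWords d) w} : ℚ) =
      1 / 2 * ((M i₀ j₀ : ℚ) - 1) * (Fintype.card I : ℚ) ^ 2 + 1 := by
  obtain ⟨q, hq⟩ := h
  rw [hM.finite_and_card.2, ← hM.branchSize_add, show M i₀ j₀ - 1 = 2 * q by omega,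
    sum_range_even_odd, hq]
  push_cast
  ring

end TreeCases

/-! ### Infinite walks and the necessity of the conditions -/

section InfiniteWords

variable {I : Type*}

/-- Local conditions on a sequence of nodes under which its finite factors are nonzero words. -/
structure CoxeterMatrix.IsAdmissibleSeq (M : CoxeterMatrix I) (d : I → ℕ) (u : ℕ → I) : Prop where
  stay : ∀ n, u n = u (n + 1) → 3 ≤ d (u n) ∧ u (n + 2) ≠ u n
  move : ∀ n, u n ≠ u (n + 1) → M (u n) (u (n + 1)) ≠ 2
  turn : ∀ n, u n ≠ u (n + 1) → u (n + 2) = u n →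
    M (u n) (u (n + 1)) = 0 ∨ (4 ≤ M (u n) (u (n + 1)) ∧ u (n + 3) ≠ u (n + 1))

theorem exists_offset_of_infix {u : ℕ → I} {n : ℕ} {f : List I}
    (h : f <:+: (List.range n).map u) : ∃ k, ∀ t (ht : t < f.length), f[t] = u (k + t) := by
  obtain ⟨s, r, h⟩ := h
  refine ⟨s.length, fun t ht => ?_⟩
  have h₁ : s.length + t < ((List.range n).map u).length := by rw [← h]; simp; omega
  have h₂ : ((List.range n).map u)[s.length + t] = u (s.length + t) := by simp
  rw [← h₂]
  simp only [← h]
  rw [List.getElem_append_left (by simp; omega), List.getElem_append_right (by omega)]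
  simp

/-- At most two equal letters are adjacent, and only where `d ≥ 3`. For finite `m`, `move` rules out
braid words with `m = 2`, the bound in `turn` those with `m = 3`, and the fourth letter in `turn`
those with `m ≥ 4`. -/
theorem CoxeterMatrix.IsAdmissibleSeq.avoids {M : CoxeterMatrix I} {d : I → ℕ}
    (hd : ∀ i, 2 ≤ d i) {u : ℕ → I} (hu : M.IsAdmissibleSeq d u) (n : ℕ) :
    Avoids (M.forbiddenWords d) ((List.range n).map u) := by
  rintro f (⟨i, rfl⟩ | ⟨i, j, hij, h0, rfl⟩) hf
  · obtain ⟨k, hk⟩ := exists_offset_of_infix hf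
    simp only [List.length_replicate, List.getElem_replicate] at hk
    have h₀ := hk 0 (by have := hd i; omega)
    have h₁ := hk 1 (by have := hd i; omega)
    rw [Nat.add_zero] at h₀
    obtain ⟨h3, hne⟩ := hu.stay k (h₀.symm.trans h₁)
    rw [← h₀] at h3 hne
    exact hne (hk 2 (by omega)).symm
  · obtain ⟨k, hk⟩ := exists_offset_of_infix hf
    have h1 := M.off_diagonal i j hij
    simp only [CoxeterSystem.length_alternatingWord] at hk
    have key : ∀ t, t < M i j → u (k + t) = if Even (M i j + t) then i else j := by
      intro t ht
      rw [← hk t ht, CoxeterSystem.getElem_alternatingWord i j _ t ht]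
    have e₀ := key 0 (by omega)
    have e₁ := key 1 (by omega)
    have hne : u k ≠ u (k + 1) ∧ M (u k) (u (k + 1)) = M i j := by
      rw [Nat.add_zero] at e₀
      rw [e₀, e₁]
      by_cases hm : Even (M i j)
      · simp [hm, Nat.even_add_one, hij]
      · simp [hm, Nat.even_add_one, hij.symm, M.symmetric j i]
    have hmove := hu.move k hne.1
    rw [hne.2] at hmove
    have e₂ := key 2 (by omega)
    have e₂₀ : u (k + 2) = u k := by
      rw [e₂, ← Nat.add_zero k, e₀]
      simp [Nat.even_add]
    rcases hu.turn k hne.1 e₂₀ with h | ⟨h, h'⟩ <;> rw [hne.2] at h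
    · exact h0 h
    · apply h'
      rw [key 3 (by omega), e₁]
      have : Even (M i j + 3) ↔ Even (M i j + 1) := by
        simp [Nat.even_add, show ¬ Even 3 by decide]
      simp only [this]

theorem CoxeterMatrix.IsAdmissibleSeq.infinite {M : CoxeterMatrix I} {d : I → ℕ}
    (hd : ∀ i, 2 ≤ d i) {u : ℕ → I} (hu : M.IsAdmissibleSeq d u) :
    Infinite {w // Avoids (M.forbiddenWords d) w} := by
  refine Infinite.of_injective (fun n => ⟨(List.range n).map u, hu.avoids hd n⟩) fun m n h => ?_
  have := congrArg (fun w => w.1.length) h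
  simpa using this

theorem CoxeterMatrix.exists_isAdmissibleSeq_of_eq_zero {M : CoxeterMatrix I} (d : I → ℕ)
    {i j : I} (hij : i ≠ j) (h : M i j = 0) : ∃ u, M.IsAdmissibleSeq d u := by
  have hs := M.symmetric i j
  refine ⟨fun n => if Even n then i else j, ⟨fun n hn => ?_, fun n hn => ?_, fun n hn h2 => ?_⟩⟩ <;>
    by_cases he : Even n <;> simp [he, Nat.even_add_one, hij, hij.symm] at hn ⊢ <;> simp [← hs, h]

/-- Running around a cycle never pauses, and never turns back because a cycle has at least three
vertices. -/
theorem CoxeterMatrix.exists_isAdmissibleSeq_of_not_isAcyclic {M : CoxeterMatrix I} (d : I → ℕ)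
    (h : ¬ M.coxeterGraph.IsAcyclic) : ∃ u, M.IsAdmissibleSeq d u := by
  simp only [SimpleGraph.IsAcyclic, not_forall, not_not] at h
  obtain ⟨v, c, hc⟩ := h
  have h3 := hc.three_le_length
  have hadj : ∀ n, M.coxeterGraph.Adj (c.getVert (n % c.length)) (c.getVert ((n + 1) % c.length)) := by
    intro n
    have hlt : n % c.length < c.length := Nat.mod_lt _ (by omega)
    have := c.adj_getVert_succ hlt
    by_cases he : n % c.length + 1 = c.length
    · rw [he, c.getVert_length] at this
      rw [Nat.add_mod, Nat.mod_eq_of_lt (show 1 < c.length by omega), he, Nat.mod_self,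
        c.getVert_zero]
      exact this
    · rwa [Nat.add_mod, Nat.mod_eq_of_lt (show 1 < c.length by omega),
        Nat.mod_eq_of_lt (show n % c.length + 1 < c.length by omega)]
  have hturn : ∀ n, c.getVert ((n + 2) % c.length) ≠ c.getVert (n % c.length) := by
    intro n hn
    have h₁ := Nat.mod_lt (n + 2) (show 0 < c.length by omega)
    have h₂ := Nat.mod_lt n (show 0 < c.length by omega)
    have := hc.getVert_injOn' (show (n + 2) % c.length ∈ {i | i ≤ c.length - 1} from by
      rw [Set.mem_ofPred_eq]; omega) (show n % c.length ∈ {i | i ≤ c.length - 1} from by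
      rw [Set.mem_ofPred_eq]; omega) hn
    have h5 : (n + 2) ≡ n + 0 [MOD c.length] := this
    have h6 := Nat.ModEq.add_left_cancel' n h5
    rw [Nat.ModEq, Nat.mod_eq_of_lt (show 2 < c.length by omega), Nat.zero_mod] at h6
    omega
  exact ⟨fun n => c.getVert (n % c.length), fun n hn => absurd hn (hadj n).ne,
    fun n _ => (hadj n).2, fun n _ hn => absurd hn (hturn n)⟩

/-- A sequence whose terms with index at most `N` form a path in the Coxeter graph. -/
structure CoxeterMatrix.IsPathSeq (M : CoxeterMatrix I) (q : ℕ → I) (N : ℕ) : Prop where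
  inj : ∀ a b, a ≤ N → b ≤ N → q a = q b → a = b
  adj : ∀ a, a < N → M (q a) (q (a + 1)) ≠ 2

/-- One step of the back-and-forth walk on `{0, …, N}`; the walk stays for one step at the end `0`
or `N` if `s` or `t`, respectively, is true. The first component is the direction. -/
def bounceStep (N : ℕ) (s t : Bool) : Bool × ℕ → Bool × ℕ
  | (true, j) => if j < N then (true, j + 1) else (false, if t then N else N - 1)
  | (false, j) => if 0 < j then (false, j - 1) else (true, if s then 0 else 1)

theorem bounceStep_le {N : ℕ} (hN : 1 ≤ N) (s t : Bool) {x : Bool × ℕ} (hx : x.2 ≤ N) :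
    (bounceStep N s t x).2 ≤ N := by
  obtain ⟨_ | _, j⟩ := x <;> cases s <;> cases t <;> simp only [bounceStep] <;> split_ifs <;>
    simp at * <;> omega

theorem bounceStep_stay {N : ℕ} (hN : 1 ≤ N) (s t : Bool) {x : Bool × ℕ} (hx : x.2 ≤ N)
    (h : x.2 = (bounceStep N s t x).2) :
    ((s = true ∧ x.2 = 0) ∨ (t = true ∧ x.2 = N)) ∧
      (bounceStep N s t (bounceStep N s t x)).2 ≠ x.2 := by
  obtain ⟨_ | _, j⟩ := x <;> cases s <;> cases t <;> simp only [bounceStep] at * <;>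
    grind

theorem bounceStep_move {N : ℕ} (s t : Bool) {x : Bool × ℕ} (hx : x.2 ≤ N)
    (h : x.2 ≠ (bounceStep N s t x).2) :
    (bounceStep N s t x).2 = x.2 + 1 ∨ x.2 = (bounceStep N s t x).2 + 1 := by
  obtain ⟨_ | _, j⟩ := x <;> cases s <;> cases t <;> simp only [bounceStep] at * <;>
    grind

/-- A turn without pause happens only at an end, and the walk then leaves that end. For `N = 1` a
pause at the other end is needed; otherwise the walk would alternate on one edge forever. -/
theorem bounceStep_turn {N : ℕ} (hN : 1 ≤ N) (s t : Bool) (hst : N = 1 → s = true ∨ t = true)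
    {x : Bool × ℕ} (hx : x.2 ≤ N) (h : x.2 ≠ (bounceStep N s t x).2)
    (h' : (bounceStep N s t (bounceStep N s t x)).2 = x.2) :
    ((s = false ∧ x.2 = 1 ∧ (bounceStep N s t x).2 = 0) ∨
      (t = false ∧ x.2 = N - 1 ∧ (bounceStep N s t x).2 = N)) ∧
      (bounceStep N s t (bounceStep N s t (bounceStep N s t x))).2 ≠ (bounceStep N s t x).2 := by
  obtain ⟨_ | _, j⟩ := x <;> cases s <;> cases t <;> simp only [bounceStep] at * <;>
    grind

/-- The walk bounces along the path, reversing at an end either by a pause (`d ≥ 3`) or by turning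
back over a multiple edge. -/
theorem CoxeterMatrix.IsPathSeq.exists_isAdmissibleSeq {M : CoxeterMatrix I} {d : I → ℕ}
    {q : ℕ → I} {N : ℕ} (hq : M.IsPathSeq q N) (hN : 1 ≤ N) (s t : Bool)
    (hst : N = 1 → s = true ∨ t = true)
    (hs : if s then 3 ≤ d (q 0) else 4 ≤ M (q 0) (q 1))
    (ht : if t then 3 ≤ d (q N) else 4 ≤ M (q (N - 1)) (q N)) :
    ∃ u, M.IsAdmissibleSeq d u := by
  let x : ℕ → Bool × ℕ := fun n => (bounceStep N s t)^[n] (true, 0)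
  have hx1 : ∀ n, x (n + 1) = bounceStep N s t (x n) := fun n =>
    Function.iterate_succ_apply' _ _ _
  have hle : ∀ n, (x n).2 ≤ N := by
    intro n
    induction n with
    | zero => exact Nat.zero_le _
    | succ n ih => rw [hx1]; exact bounceStep_le hN s t ih
  have hiff : ∀ m n, q (x m).2 = q (x n).2 ↔ (x m).2 = (x n).2 := fun m n =>
    ⟨hq.inj _ _ (hle m) (hle n), fun h => by rw [h]⟩
  refine ⟨fun n => q (x n).2, ⟨fun n h => ?_, fun n h => ?_, fun n h h' => ?_⟩⟩
  · rw [hiff, hx1] at h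
    obtain ⟨h₁, h₂⟩ := bounceStep_stay hN s t (hle n) h
    rw [Ne, hiff, hx1, hx1]
    refine ⟨?_, h₂⟩
    rcases h₁ with ⟨rfl, h₁⟩ | ⟨rfl, h₁⟩ <;> simpa [h₁] using by assumption
  · rw [Ne, hiff, hx1] at h
    have h₂ := hle (n + 1)
    rw [hx1] at h₂ ⊢
    rcases bounceStep_move s t (hle n) h with h₁ | h₁
    · rw [h₁] at h₂ ⊢
      exact hq.adj _ (by omega)
    · rw [M.symmetric, h₁]
      have := hle n
      exact hq.adj _ (by omega)
  · rw [Ne, hiff, hx1] at h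
    rw [hiff, hx1, hx1] at h'
    obtain ⟨h₁, h₂⟩ := bounceStep_turn hN s t hst (hle n) h h'
    refine Or.inr ⟨?_, by rwa [Ne, hiff, hx1, hx1, hx1]⟩
    rw [hx1]
    rcases h₁ with ⟨rfl, h₁, h₁'⟩ | ⟨rfl, h₁, h₁'⟩ <;> rw [h₁, h₁']
    · rw [M.symmetric]; simpa using hs
    · simpa using ht

theorem CoxeterMatrix.exists_isPathSeq {M : CoxeterMatrix I} (hW : M.coxeterGraph.Connected)
    (i j : I) : ∃ q N, M.IsPathSeq q N ∧ q 0 = i ∧ q N = j := by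
  obtain ⟨p, hp⟩ := (hW.preconnected i j).exists_isPath
  refine ⟨p.getVert, p.length, ⟨fun a b ha hb h => hp.getVert_injOn ?_ ?_ h, fun a ha => ?_⟩,
    p.getVert_zero, p.getVert_length⟩
  · rwa [Set.mem_ofPred_eq]
  · rwa [Set.mem_ofPred_eq]
  · exact (p.adj_getVert_succ ha).2

/-- Take a path from `i` to `k`. If it meets `j`, replace the part before `j` by `i`; otherwise
prepend `j`. -/
theorem CoxeterMatrix.exists_isPathSeq_of_edge {M : CoxeterMatrix I}
    (hW : M.coxeterGraph.Connected) {i j : I} (hij : M.coxeterGraph.Adj i j) (k : I) :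
    ∃ q N, M.IsPathSeq q N ∧ 1 ≤ N ∧ s(q 0, q 1) = s(i, j) ∧ q N = k := by
  obtain ⟨p, N, hp, h0, hN⟩ := exists_isPathSeq hW i k
  by_cases h : ∃ a ≤ N, p a = j
  · obtain ⟨a, ha, hpa⟩ := h
    have ha0 : a ≠ 0 := by rintro rfl; exact hij.ne (h0.symm.trans hpa)
    refine ⟨fun n => if n = 0 then i else p (a + n - 1), N - a + 1, ⟨fun b c hb hc h => ?_,
      fun b hb => ?_⟩, by omega, by simp [hpa], ?_⟩
    · have h₁ := fun y hy => hp.inj 0 y (Nat.zero_le _) hy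
      have h₂ := hp.inj (a + b - 1) (a + c - 1) (by omega) (by omega)
      have h₃ := h₁ (a + b - 1) (by omega)
      have h₄ := h₁ (a + c - 1) (by omega)
      rw [h0] at h₃ h₄
      split_ifs at h with e₁ e₂ e₂
      · omega
      · have := h₄ h; omega
      · have := h₃ h.symm; omega
      · have := h₂ h; omega
    · by_cases hb0 : b = 0
      · subst hb0
        simpa [hpa] using hij.2
      · have := hp.adj (a + b - 1) (by omega)
        rw [show a + b - 1 + 1 = a + (b + 1) - 1 by omega] at this
        simpa [hb0] using this
    · simp only [Nat.add_eq_zero_iff, one_ne_zero, and_false, if_false]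
      rw [show a + (N - a + 1) - 1 = N by omega, hN]
  · push Not at h
    refine ⟨fun n => if n = 0 then j else p (n - 1), N + 1, ⟨fun b c hb hc h' => ?_,
      fun b hb => ?_⟩, by omega, by simp [h0, Sym2.eq_swap], by simpa using hN⟩
    · have h₂ := hp.inj (b - 1) (c - 1) (by omega) (by omega)
      have h₃ := h (b - 1) (by omega)
      have h₄ := h (c - 1) (by omega)
      split_ifs at h' with e₁ e₂ e₂
      · omega
      · exact absurd h'.symm h₄
      · exact absurd h' h₃
      · have := h₂ h'; omega
    · by_cases hb0 : b = 0
      · subst hb0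
        simpa [h0] using hij.symm.2
      · have := hp.adj (b - 1) (by omega)
        rw [show b - 1 + 1 = b by omega] at this
        simpa [hb0] using this

/-- Extend a path that starts with the first edge and ends at `k`. If it misses `l`, append `l`; if
it meets `l` after its start, cut there and append `k`. If it starts at `l`, the edges share `l`,
and `k, l, q 1` is the path, with the edges in the other order. -/
theorem CoxeterMatrix.exists_isPathSeq_of_two_edges {M : CoxeterMatrix I}
    (hW : M.coxeterGraph.Connected) {i j k l : I} (hij : M.coxeterGraph.Adj i j)
    (hkl : M.coxeterGraph.Adj k l) (hne : s(i, j) ≠ s(k, l)) :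
    ∃ q N, M.IsPathSeq q N ∧ 2 ≤ N ∧ (s(q 0, q 1) = s(i, j) ∧ s(q (N - 1), q N) = s(k, l) ∨
      s(q 0, q 1) = s(k, l) ∧ s(q (N - 1), q N) = s(i, j)) := by
  have snoc : ∀ (q : ℕ → I) (N : ℕ) (c : I), M.IsPathSeq q N → (∀ a ≤ N, q a ≠ c) →
      M (q N) c ≠ 2 → M.IsPathSeq (fun n => if n ≤ N then q n else c) (N + 1) := by
    intro q N c hq hc hadj
    refine ⟨fun a b ha hb h => ?_, fun a ha => ?_⟩
    · split_ifs at h with e₁ e₂ e₂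
      · exact hq.inj a b e₁ e₂ h
      · exact absurd h (hc a e₁)
      · exact absurd h.symm (hc b e₂)
      · omega
    · by_cases haN : a = N
      · subst haN; simpa using hadj
      · have h₁ : a ≤ N := by omega
        have h₂ : a + 1 ≤ N := by omega
        simpa [h₁, h₂] using hq.adj a (by omega)
  obtain ⟨q, N, hq, hN, h01, hqN⟩ := exists_isPathSeq_of_edge hW hij k
  by_cases h : ∃ a ≤ N, q a = l
  · obtain ⟨a, ha, hqa⟩ := h
    have haN : a ≠ N := by rintro rfl; exact hkl.ne (hqN.symm.trans hqa)
    by_cases ha0 : a = 0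
    · subst ha0
      have h1k : q 1 ≠ k := by
        intro e
        rw [hqa, e, Sym2.eq_swap] at h01
        exact hne h01.symm
      have h0 := hq.adj 0 (by omega)
      have hlq : l ≠ q 1 := fun e => by
        have := hq.inj 0 1 (by omega) hN (hqa.trans e)
        omega
      rw [hqa] at h0 h01
      refine ⟨fun n => if n ≤ 1 then (if n ≤ 0 then k else l) else q 1, 2,
        snoc _ 1 (q 1) (snoc (fun _ => k) 0 l ⟨fun a b ha hb _ => by omega, fun a ha => by omega⟩
          (fun _ _ => hkl.ne) hkl.2) ?_ (by simpa using h0), le_rfl, Or.inr ?_⟩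
      · intro a ha
        split_ifs
        · exact h1k.symm
        · exact hlq
      · simpa using h01
    · refine ⟨_, a + 1, snoc q a k ⟨fun b c hb hc => hq.inj b c (by omega) (by omega),
        fun b hb => hq.adj b (by omega)⟩ (fun b hb e => ?_) ?_, by omega, Or.inl ?_⟩
      · have := hq.inj b N (by omega) le_rfl (e.trans hqN.symm)
        omega
      · rw [hqa]; exact hkl.symm.2
      · have : 1 ≤ a := by omega
        simpa [this, hqa, Sym2.eq_swap (a := l)] using h01
  · push Not at h
    refine ⟨_, N + 1, snoc q N l hq h (by rw [hqN]; exact hkl.2), by omega, Or.inl ?_⟩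
    simpa [hN, hqN] using h01

/-- If only finitely many words are nonzero, then the Coxeter graph and the exponents are those of
the classification. -/
theorem CoxeterMatrix.classification_of_finite {M : CoxeterMatrix I}
    (hW : M.coxeterGraph.Connected) {d : I → ℕ} (hd : ∀ i, 2 ≤ d i)
    (hfin : Finite {w // Avoids (M.forbiddenWords d) w}) :
    (∃ i₀ j₀, M.IsOneMultipleEdgeTree d i₀ j₀) ∨ M.IsSimplyLacedTree d := by
  have hno : ¬ ∃ u, M.IsAdmissibleSeq d u := fun ⟨u, hu⟩ =>
    (hu.infinite hd).not_finite hfin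
  have hzero : ∀ i j, i ≠ j → M i j ≠ 0 := fun i j hij h =>
    hno (exists_isAdmissibleSeq_of_eq_zero d hij h)
  have htree : M.coxeterGraph.IsTree := ⟨hW, by
    by_contra h
    exact hno (exists_isAdmissibleSeq_of_not_isAcyclic d h)⟩
  have hmult : ∀ {i j}, s(i, j) ∈ M.multipleEdges → M.coxeterGraph.Adj i j ∧ 4 ≤ M i j := by
    intro i j h
    obtain ⟨hij, h⟩ := mem_multipleEdges_iff.1 h
    have := hzero i j hij
    exact ⟨⟨hij, by omega⟩, by omega⟩
  by_cases he : M.multipleEdges = ∅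
  · refine Or.inr ⟨htree, he, fun i hi j hj => ?_⟩
    by_contra hij
    -- Two nodes with `d ≥ 3`: pause at both ends of a path between them.
    obtain ⟨q, N, hq, h0, hN⟩ := exists_isPathSeq hW i j
    have : N ≠ 0 := by rintro rfl; exact hij (h0.symm.trans hN)
    exact hno (hq.exists_isAdmissibleSeq (d := d) (by omega) true true (fun _ => Or.inl rfl)
      (by simpa [h0] using hi) (by simpa [hN] using hj))
  · obtain ⟨e, he⟩ := Set.nonempty_iff_ne_empty.2 he
    induction e using Sym2.ind with | _ i j
    refine Or.inl ⟨i, j, htree, ?_, (hmult he).2, fun k => ?_⟩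
    · refine Set.eq_singleton_iff_unique_mem.2 ⟨he, fun f hf => ?_⟩
      induction f using Sym2.ind with | _ k l
      by_contra hne
      -- Two multiple edges: turn back over both, at the ends of a path.
      obtain ⟨q, N, hq, hN, h⟩ := exists_isPathSeq_of_two_edges hW (hmult hf).1 (hmult he).1 hne
      have h' : s(q 0, q 1) ∈ M.multipleEdges ∧ s(q (N - 1), q N) ∈ M.multipleEdges := by
        rcases h with h | h <;> rw [h.1, h.2] <;> exact ⟨by assumption, by assumption⟩
      exact hno (hq.exists_isAdmissibleSeq (d := d) (by omega) false false (fun _ => by omega)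
        (by simpa using (hmult h'.1).2) (by simpa using (hmult h'.2).2))
    · by_contra hk
      have hk3 : 3 ≤ d k := by have := hd k; omega
      -- A multiple edge and a node with `d ≥ 3`: turn back at one end, pause at the other.
      obtain ⟨q, N, hq, hN, h, hqN⟩ := exists_isPathSeq_of_edge hW (hmult he).1 k
      rw [← h] at he
      exact hno (hq.exists_isAdmissibleSeq (d := d) hN false true (fun _ => Or.inr rfl)
        (by simpa using (hmult he).2) (by simpa [hqN] using hk3))

end InfiniteWords

/-! ### The classification and the ranks -/

theorem CoxeterMatrix.IsSimplyLacedTree.exists_center {I : Type*} {M : CoxeterMatrix I}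
    {d : I → ℕ} (hM : M.IsSimplyLacedTree d) (hd : ∀ i, 2 ≤ d i) :
    ∃ i₀, ∀ i, i ≠ i₀ → d i = 2 := by
  by_cases h : ∃ i₀, 3 ≤ d i₀
  · obtain ⟨i₀, h₀⟩ := h
    refine ⟨i₀, fun i hi => ?_⟩
    by_contra h
    have := hd i
    exact hi (hM.2.2 (show 3 ≤ d i by omega) h₀)
  · push Not at h
    obtain ⟨i₀⟩ := hM.1.connected.nonempty
    exact ⟨i₀, fun i _ => by have := hd i; have := h i; omega⟩

theorem mainTheorem3 {𝕜 : Type*} [CommRing 𝕜] [Nontrivial 𝕜] {I : Type*} [Fintype I]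
    (M : CoxeterMatrix I) (hW : M.coxeterGraph.Connected) (d : I → ℕ) (hd : ∀ i, 2 ≤ d i) :
    M.braidIndexLT 1 = M.braidIndexLT 2 ∧
    ∀ k : ℕ, k = 1 ∨ k = 2 →
      (Module.Finite 𝕜 (NilHecke 𝕜 M d (M.braidIndexLT k)) ↔
        Xor (∃ i₀ j₀ : I, M.IsOneMultipleEdgeTree d i₀ j₀) (M.IsSimplyLacedTree d)) ∧
      (∀ i₀ j₀ : I, M.IsOneMultipleEdgeTree d i₀ j₀ →
        Module.Free 𝕜 (NilHecke 𝕜 M d (M.braidIndexLT k)) ∧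
        (Even (M i₀ j₀) →
          (Module.finrank 𝕜 (NilHecke 𝕜 M d (M.braidIndexLT k)) : ℚ) =
            1 / 2 * (M i₀ j₀ : ℚ) * (Fintype.card I : ℚ) ^ 2 + 1
              - 2 * (M.branchSize i₀ j₀ : ℚ) * (M.branchSize j₀ i₀ : ℚ)) ∧
        (Odd (M i₀ j₀) →
          (Module.finrank 𝕜 (NilHecke 𝕜 M d (M.braidIndexLT k)) : ℚ) =
            1 / 2 * ((M i₀ j₀ : ℚ) - 1) * (Fintype.card I : ℚ) ^ 2 + 1)) ∧
      (M.IsSimplyLacedTree d → ∀ i₀ : I, (∀ i, i ≠ i₀ → d i = 2) →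
        Module.Free 𝕜 (NilHecke 𝕜 M d (M.braidIndexLT k)) ∧
        (Module.finrank 𝕜 (NilHecke 𝕜 M d (M.braidIndexLT k)) : ℚ) =
          1 + (Fintype.card I : ℚ) ^ 2 * ((d i₀ : ℚ) - 1)) := by
  refine ⟨by rw [M.braidIndexLT_eq_empty one_le_two, M.braidIndexLT_eq_empty le_rfl],
    fun k hk => ?_⟩
  rw [M.braidIndexLT_eq_empty (show k ≤ 2 by omega)]
  obtain ⟨B⟩ := exists_basis_nilHecke_empty 𝕜 M d hd
  have hfree : Module.Free 𝕜 (NilHecke 𝕜 M d ∅) := .of_basis B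
  have hrank := Module.finrank_eq_nat_card_basis B
  have hfin : Module.Finite 𝕜 (NilHecke 𝕜 M d ∅) ↔
      Finite {w // Avoids (M.forbiddenWords d) w} :=
    ⟨fun _ => Module.Finite.finite_basis B, fun _ => .of_basis B⟩
  refine ⟨⟨fun h => ?_, fun h => hfin.2 ?_⟩, fun i₀ j₀ hM => ⟨hfree, fun h => ?_, fun h => ?_⟩,
    fun hM i₀ h₀ => ⟨hfree, ?_⟩⟩
  · have hexcl : ¬ ((∃ i₀ j₀ : I, M.IsOneMultipleEdgeTree d i₀ j₀) ∧ M.IsSimplyLacedTree d) := by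
      rintro ⟨⟨i₀, j₀, h₁⟩, h₂⟩
      exact Set.singleton_ne_empty _ (h₁.2.1.symm.trans h₂.2.1)
    rcases M.classification_of_finite hW hd (hfin.1 h) with h | h
    · exact Or.inl ⟨h, fun h' => hexcl ⟨h, h'⟩⟩
    · exact Or.inr ⟨h, fun h' => hexcl ⟨h', h⟩⟩
  · rcases h with ⟨⟨i₀, j₀, h⟩, -⟩ | ⟨h, -⟩
    · exact h.finite_and_card.1
    · obtain ⟨i₀, h₀⟩ := h.exists_center hd
      exact (h.finite_and_card hd h₀).1
  · rw [hrank, hM.card_of_even h]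
  · rw [hrank, hM.card_of_odd h]
  · rw [hrank, (hM.finite_and_card hd h₀).2]
    push_cast [Nat.cast_sub (show 1 ≤ d i₀ by have := hd i₀; omega)]
    ring
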